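/- Let $q\ge 3$ be a prime power and let $c$ be an integer with $2\le c<q$. Then there exists a quantum code with parameters $[[q^2-1,\;q^2-4c+5,\;d\ge c]]_q$, i.e. a subspace of $(\mathbb{C}^q)^{\otimes (q^2-1)}$ of dimension $q^{\,q^2-4c+5}$ that has minimum distance at least $c$ (with $P$ the orthogonal projection onto the subspace, every operator $E$ acting on fewer than $c$ of the $q^2-1$ qudits satisfies $PEP=\lambda_E P$ for some $\lambda_E\in\mathbb{C}$). More precisely, let $n=q^2-1$, let $\alpha$ be a primitive element of $\mathbb{F}_{q^2}$, and let $M^{(i)}(x)$ be the minimal polynomial of $\alpha^i$ over $\mathbb{F}_q$. Let $C_1$ be the BCH code of length $n$ over $\mathbb{F}_q$ generated by the product of the distinct polynomials among $M^{(0)}(x),M^{(1)}(x),\dots,M^{(c-2)}(x)$, and let $C_2$ be the cyclic code of length $n$ over $\mathbb{F}_q$ generated by the product of all distinct polynomials $M^{(i)}(x)$, $0\le i<n$, other than $M^{(q+1)}(x),\dots,M^{(q+c-1)}(x)$. Then $C_2\subseteq C_1$, and the CSS code of $C_1$ and $C_2$, i.e. the span of the vectors $\sum_{y\in C_2}|x+y\rangle$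 with $x\in C_1$, is such an $[[q^2-1,\;q^2-4c+5,\;d\ge c]]_q$ quantum code. -/

import Mathlib

/-! ### Quantum codes on `n` qudits -/

/-- The Hilbert space `(ℂ^A)^{⊗ n}` of `n` qudits whose levels are labelled by the finite type `A`,
written in the computational basis `|x⟩ = |x₁⟩ ⊗ ⋯ ⊗ |xₙ⟩`, `x : Fin n → A`. -/
abbrev QuditSpace (A : Type*) [Fintype A] (n : ℕ) : Type _ :=
  EuclideanSpace ℂ (Fin n → A)

/-- The operator with matrix `E` on `n` qudits acts only on the qudits in `S`, i.e. it has the form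
`M ⊗ 1` with `M` an operator on the qudits in `S` and `1` the identity on all the others: the entry
`⟨x|E|y⟩` vanishes unless `x` and `y` agree outside `S`, and then it depends only on the
restrictions of `x` and `y` to `S`. -/
def ActsOn {A : Type*} {n : ℕ} (S : Finset (Fin n))
    (E : Matrix (Fin n → A) (Fin n → A) ℂ) : Prop :=
  (∀ x y, (∃ i, i ∉ S ∧ x i ≠ y i) → E x y = 0) ∧
  (∀ x y x' y', (∀ i, i ∉ S → x i = y i) → (∀ i, i ∉ S → x' i = y' i) →
    (∀ i, i ∈ S → x i = x' i ∧ y i = y' i) → E x y = E x' y')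

/-- The quantum code `Q` detects the error `E`: with `P` the orthogonal projection onto `Q`, one
has `P E P = l • P` for some scalar `l` (the Knill-Laflamme condition), written through inner
products of code vectors. -/
def Detects {A : Type*} [Fintype A] {n : ℕ} (Q : Submodule ℂ (QuditSpace A n))
    (E : Matrix (Fin n → A) (Fin n → A) ℂ) : Prop :=
  ∃ l : ℂ, ∀ u ∈ Q, ∀ v ∈ Q,
    inner ℂ u (WithLp.toLp 2 (E.mulVec (WithLp.ofLp v)) : QuditSpace A n) = l * inner ℂ u v

/-- `Q` is an `[[n, k, d' ≥ d]]_q` quantum code, where `q` is the number of elements of `A`: a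
subspace of dimension `q ^ k` of the space of `n` `q`-level qudits, of minimum distance at least
`d`, i.e. detecting every error that acts on fewer than `d` qudits.
(For `k = 0` the literature uses a different convention for the distance; here only `k > 0`
occurs.) -/
def IsQuantumCode {A : Type*} [Fintype A] {n : ℕ} (Q : Submodule ℂ (QuditSpace A n))
    (k d : ℕ) : Prop :=
  Module.finrank ℂ Q = Fintype.card A ^ k ∧
  ∀ S : Finset (Fin n), S.card < d →
    ∀ E : Matrix (Fin n → A) (Fin n → A) ℂ, ActsOn S E → Detects Q E

/-! ### The CSS construction -/

/-- The (unnormalized) coset state `∑_{y ∈ C} |x + y⟩`. -/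
noncomputable def cosetState {F : Type*} [Field F] [Fintype F] {n : ℕ}
    (C : Submodule F (Fin n → F)) (x : Fin n → F) : QuditSpace F n :=
  WithLp.toLp 2 (Set.indicator {y : Fin n → F | y - x ∈ C} (fun _ => (1 : ℂ)))

/-- The CSS code of two classical linear codes `C₂ ≤ C₁`: the span of the coset states
`∑_{y ∈ C₂} |x + y⟩`, `x ∈ C₁`. -/
noncomputable def cssCode {F : Type*} [Field F] [Fintype F] {n : ℕ}
    (C₁ C₂ : Submodule F (Fin n → F)) : Submodule ℂ (QuditSpace F n) :=
  Submodule.span ℂ {w | ∃ x ∈ C₁, w = cosetState C₂ x}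

/-! ### Cyclic codes -/

/-- The cyclic code of length `n` over `F` with generator polynomial `g` (a divisor of `X ^ n - 1`):
all `(v₀, …, v_{n-1})` for which `g` divides `v₀ + v₁ X + ⋯ + v_{n-1} X ^ (n-1)`. -/
noncomputable def cyclicCode {F : Type*} [Field F] (n : ℕ) (g : Polynomial F) :
    Submodule F (Fin n → F) where
  carrier := {v | g ∣ ∑ i : Fin n, Polynomial.C (v i) * Polynomial.X ^ (i : ℕ)}
  zero_mem' := by simp
  add_mem' := by
    intro a b ha hb
    simpa [add_mul, Finset.sum_add_distrib] using dvd_add ha hb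
  smul_mem' := by
    intro r a ha
    have h := Dvd.dvd.mul_left ha (Polynomial.C r)
    simpa [Finset.mul_sum, mul_assoc] using h

open Classical in
/-- The set of the minimal polynomials `M^{(i)}` over `F` of the powers `α ^ i`, `i ∈ I`. -/
noncomputable def minpolySet (F : Type*) {K : Type*} [Field F] [Field K] [Algebra F K] (α : K)
    (I : Finset ℕ) : Finset (Polynomial F) :=
  I.image (fun i => minpoly F (α ^ i))

/-- The generator polynomial of the BCH code with zeros `α ^ 0, …, α ^ (c - 2)`: the product of the
distinct polynomials among `M^{(0)}, …, M^{(c-2)}` (equivalently, their least common multiple). -/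
noncomputable def genPolyOne (F : Type*) {K : Type*} [Field F] [Field K] [Algebra F K] (α : K)
    (c : ℕ) : Polynomial F :=
  ∏ p ∈ minpolySet F α (Finset.range (c - 1)), p

open Classical in
/-- The product of all distinct minimal polynomials `M^{(i)}`, `0 ≤ i < n`, other than
`M^{(q+1)}, …, M^{(q+c-1)}`. -/
noncomputable def genPolyTwo (F : Type*) {K : Type*} [Field F] [Field K] [Algebra F K] (α : K)
    (n q c : ℕ) : Polynomial F :=
  ∏ p ∈ minpolySet F α (Finset.range n) \ minpolySet F α (Finset.Icc (q + 1) (q + c - 1)), p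

/-! Let `E` act on fewer than `c` qudits, those in `S`. If `C₁` has minimum distance at least `c`,
then `E` has no entry between distinct words of `C₁`. If `C₂` takes all values on `S`, then
translating by a word of `C₂` makes the diagonal sums over all cosets equal. This is the
Knill-Laflamme condition (`isQuantumCode_cssCode`).

Both requirements follow from the BCH bound `eq_zero_of_forall_sum_mul_pow_eq_zero` with `c - 1`
consecutive zeros. For `C₁` these are `α ^ 0, …, α ^ (c - 2)`. By `exists_mem_eq_on_of_dual`, the
requirement on `C₂` concerns its dual. The code `C₂` contains the vectors `(Tr(a * x⁻¹ ^ j))_j` for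
`x = α ^ (q + 1), …, α ^ (q + c - 1)`, so a vector orthogonal to `C₂` has the zeros `x⁻¹`, again
consecutive.

Conjugation over `F` multiplies exponents by `q` modulo `n = q ^ 2 - 1`. Each window `0, …, c - 2`
and `q + 1, …, q + c - 1` has one fixed exponent, its first, and no two exponents of the windows are
conjugate. Each window thus gives a product of degree `2c - 3`, so the dimensions are `n - (2c - 3)`
and `2c - 3`, with difference `q ^ 2 - 4c + 5`. -/

section CSS

variable {F : Type*} [Field F] [Fintype F] {n : ℕ}

/-! ### CSS codes -/

theorem cosetState_apply (C : Submodule F (Fin n → F)) (x y : Fin n → F) [Decidable (y - x ∈ C)] :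
    cosetState C x y = if y - x ∈ C then 1 else 0 := by
  simp [cosetState, Set.indicator_apply]

theorem cosetState_eq_of_sub_mem {C : Submodule F (Fin n → F)} {x x' : Fin n → F}
    (h : x - x' ∈ C) : cosetState C x = cosetState C x' := by
  classical
  ext y
  rw [cosetState_apply, cosetState_apply]
  have : y - x ∈ C ↔ y - x' ∈ C := by
    rw [← sub_add_sub_cancel y x x', C.add_mem_iff_left h]
  simp [this]

theorem inner_cosetState_mulVec (C : Submodule F (Fin n → F)) (x x' : Fin n → F)
    (E : Matrix (Fin n → F) (Fin n → F) ℂ) [Fintype C] :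
    inner ℂ (cosetState C x) (WithLp.toLp 2 (E.mulVec (WithLp.ofLp (cosetState C x'))) :
      QuditSpace F n) = ∑ a : C, ∑ b : C, E (x + a) (x' + b) := by
  classical
  have key : ∀ (f : (Fin n → F) → ℂ) (z : Fin n → F),
      ∑ y, (if y - z ∈ C then f y else 0) = ∑ a : C, f (z + a) := by
    intro f z
    rw [← Finset.sum_filter]
    symm
    refine Finset.sum_bij (fun a _ => z + a) (by simp) (by simp) ?_ (by simp)
    intro y hy
    exact ⟨⟨y - z, (Finset.mem_filter.1 hy).2⟩, by simp, by simp⟩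
  rw [PiLp.inner_apply, ← key (fun y => ∑ b : C, E y (x' + b))]
  refine Finset.sum_congr rfl fun y _ => ?_
  rw [cosetState_apply, ← key (fun w => E y w)]
  split_ifs with h
  · simp only [Matrix.mulVec, dotProduct, RCLike.inner_apply, map_one, mul_one]
    refine Finset.sum_congr rfl fun w _ => ?_
    rw [cosetState_apply]
    split_ifs <;> simp
  · simp

theorem inner_cosetState (C : Submodule F (Fin n → F)) (x x' : Fin n → F)
    [Decidable (x - x' ∈ C)] :
    inner ℂ (cosetState C x) (cosetState C x') =
      if x - x' ∈ C then (Nat.card C : ℂ) else 0 := by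
  classical
  have h := fun x' => inner_cosetState_mulVec C x x' 1
  simp only [Matrix.one_mulVec, WithLp.toLp_ofLp] at h
  split_ifs with hx
  · have hone : ∀ a b : C, (1 : Matrix (Fin n → F) (Fin n → F) ℂ) (x + a) (x + b) =
        if a = b then 1 else 0 := by
      intro a b
      rw [Matrix.one_apply]
      exact if_congr (by rw [add_right_inj, Subtype.ext_iff]) rfl rfl
    rw [← cosetState_eq_of_sub_mem hx, h]
    simp [hone]
  · rw [h]
    refine Finset.sum_eq_zero fun a _ => Finset.sum_eq_zero fun b _ => Matrix.one_apply_ne ?_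
    intro he
    apply hx
    have : x - x' = b - a := by rw [sub_eq_sub_iff_add_eq_add, he, add_comm]
    rw [this]
    exact C.sub_mem b.2 a.2

/-- Distinct cosets of `C₂` in `C₁` give nonzero, pairwise orthogonal states, so the dimension is
the number of cosets. -/
theorem finrank_cssCode {C₁ C₂ : Submodule F (Fin n → F)} (h : C₂ ≤ C₁) {k : ℕ}
    (hk : Module.finrank F C₁ = Module.finrank F C₂ + k) :
    Module.finrank ℂ (cssCode C₁ C₂) = Fintype.card F ^ k := by
  classical
  let D : Submodule F C₁ := C₂.submoduleOf C₁
  let v : (C₁ ⧸ D) → QuditSpace F n := fun t => cosetState C₂ (t.out : C₁)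
  have hmem : ∀ x y : C₁, (Submodule.Quotient.mk x : C₁ ⧸ D) = Submodule.Quotient.mk y ↔
      (x : Fin n → F) - y ∈ C₂ := by
    intro x y
    rw [Submodule.Quotient.eq]; rfl
  have hout : ∀ t : C₁ ⧸ D, Submodule.Quotient.mk t.out = t := Quotient.out_eq
  have hspan : cssCode C₁ C₂ = Submodule.span ℂ (Set.range v) := by
    refine congrArg (Submodule.span ℂ) (Set.ext fun w => ?_)
    constructor
    · rintro ⟨x, hx, rfl⟩
      refine ⟨Submodule.Quotient.mk ⟨x, hx⟩, cosetState_eq_of_sub_mem ?_⟩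
      exact (hmem _ ⟨x, hx⟩).1 (hout _)
    · rintro ⟨t, rfl⟩
      exact ⟨_, t.out.2, rfl⟩
  have hne : (Nat.card C₂ : ℂ) ≠ 0 := by exact_mod_cast Nat.card_pos.ne'
  have hli : LinearIndependent ℂ v := by
    refine linearIndependent_of_ne_zero_of_inner_eq_zero (fun t ht => ?_) fun s t hst => ?_
    · have := inner_cosetState C₂ (t.out : C₁) (t.out : C₁)
      rw [show cosetState C₂ (t.out : C₁) = 0 from ht, inner_zero_left, sub_self,
        if_pos C₂.zero_mem] at this
      exact hne this.symm
    · change inner ℂ (cosetState C₂ (s.out : C₁)) (cosetState C₂ (t.out : C₁)) = 0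
      rw [inner_cosetState, if_neg]
      rw [← hmem, hout, hout]
      exact hst
  have := Fintype.ofFinite (C₁ ⧸ D)
  rw [hspan, finrank_span_eq_card hli, Module.card_eq_pow_finrank (K := F)]
  congr 1
  have h1 := D.finrank_quotient_add_finrank
  have h2 : Module.finrank F D = Module.finrank F C₂ :=
    (Submodule.submoduleOfEquivOfLe h).finrank_eq
  omega

theorem detects_span {A : Type*} [Fintype A] {s : Set (QuditSpace A n)}
    {E : Matrix (Fin n → A) (Fin n → A) ℂ} (l : ℂ)
    (h : ∀ u ∈ s, ∀ v ∈ s, inner ℂ u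
      (WithLp.toLp 2 (E.mulVec (WithLp.ofLp v)) : QuditSpace A n) = l * inner ℂ u v) :
    Detects (Submodule.span ℂ s) E := by
  refine ⟨l, fun u hu v hv => ?_⟩
  induction hu, hv using Submodule.span_induction₂ with
  | mem_mem u v hu hv => exact h u hu v hv
  | zero_left => simp
  | zero_right => simp
  | add_left x y z _ _ _ h1 h2 => simp only [inner_add_left, h1, h2, mul_add]
  | add_right x y z _ _ _ h1 h2 =>
    simp only [WithLp.ofLp_add, Matrix.mulVec_add, WithLp.toLp_add, inner_add_right, h1, h2,
      mul_add]
  | smul_left r x y _ _ h1 => simp only [inner_smul_left, h1]; ring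
  | smul_right r x y _ _ h1 =>
    simp only [WithLp.ofLp_smul, Matrix.mulVec_smul, WithLp.toLp_smul, inner_smul_right, h1]
    ring

/-- A CSS code detects the errors on fewer than `d` qudits as soon as `C₁` has minimum distance at
least `d` and `C₂` takes all values on every set of fewer than `d` positions. -/
theorem isQuantumCode_cssCode {C₁ C₂ : Submodule F (Fin n → F)} (h : C₂ ≤ C₁) {k d : ℕ}
    (hk : Module.finrank F C₁ = Module.finrank F C₂ + k)
    (h₁ : ∀ S : Finset (Fin n), S.card < d → ∀ v ∈ C₁, (∀ i ∉ S, v i = 0) → v = 0)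
    (h₂ : ∀ S : Finset (Fin n), S.card < d → ∀ x : Fin n → F, ∃ w ∈ C₂, ∀ i ∈ S, w i = x i) :
    IsQuantumCode (cssCode C₁ C₂) k d := by
  classical
  refine ⟨finrank_cssCode h hk, fun S hS E hE => ?_⟩
  -- The scalar is the mean of the diagonal of `E` over `C₂`.
  refine detects_span ((∑ a : C₂, E a a) / Nat.card C₂) ?_
  rintro _ ⟨x, hx, rfl⟩ _ ⟨x', hx', rfl⟩
  have hoff : ∀ y ∈ C₁, ∀ y' ∈ C₁, y ≠ y' → E y y' = 0 := by
    intro y hy y' hy' hne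
    apply hE.1
    by_contra! hcon
    refine hne (sub_eq_zero.1 (h₁ S hS _ (C₁.sub_mem hy hy') fun i hi => ?_))
    rw [Pi.sub_apply, hcon i hi, sub_self]
  by_cases hxx : x - x' ∈ C₂
  · rw [← cosetState_eq_of_sub_mem hxx, inner_cosetState_mulVec, inner_cosetState, sub_self,
      if_pos C₂.zero_mem, div_mul_cancel₀ _ (by exact_mod_cast Nat.card_pos.ne')]
    have hdiag : ∀ a : C₂, ∑ b : C₂, E (x + a) (x + b) = E (x + a) (x + a) := by
      intro a
      refine Finset.sum_eq_single a (fun b _ hb => ?_) (by simp)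
      refine hoff _ (C₁.add_mem hx (h a.2)) _ (C₁.add_mem hx (h b.2)) fun he => hb ?_
      exact Subtype.ext (add_left_cancel he).symm
    simp only [hdiag]
    -- `x + a` and `w + a` agree on `S`, so `E` has the same diagonal entry at both, and `a ↦ w + a`
    -- permutes `C₂`.
    obtain ⟨w, hw, hwx⟩ := h₂ S hS x
    rw [← Equiv.sum_comp (Equiv.addLeft (⟨w, hw⟩ : C₂)) fun a : C₂ => E a a]
    refine Finset.sum_congr rfl fun a _ => ?_
    refine hE.2 _ _ _ _ (by simp) (by simp) fun i hi => ?_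
    simp [hwx i hi]
  · rw [inner_cosetState_mulVec, inner_cosetState, if_neg hxx, mul_zero]
    refine Finset.sum_eq_zero fun a _ => Finset.sum_eq_zero fun b _ => ?_
    refine hoff _ (C₁.add_mem hx (h a.2)) _ (C₁.add_mem hx' (h b.2)) fun he => hxx ?_
    have : x - x' = b - a := by rw [sub_eq_sub_iff_add_eq_add, he, add_comm]
    rw [this]
    exact C₂.sub_mem b.2 a.2

end CSS

/-- Relabelling the levels of the qudits preserves quantum codes. -/
theorem IsQuantumCode.relabel {A B : Type*} [Fintype A] [Fintype B] {n k d : ℕ} (e : A ≃ B)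
    {Q : Submodule ℂ (QuditSpace A n)} (hQ : IsQuantumCode Q k d) :
    ∃ Q' : Submodule ℂ (QuditSpace B n), IsQuantumCode Q' k d := by
  let f : (Fin n → A) ≃ (Fin n → B) := (Equiv.refl (Fin n)).arrowCongr e
  let U : QuditSpace A n ≃ₗᵢ[ℂ] QuditSpace B n := LinearIsometryEquiv.piLpCongrLeft 2 ℂ ℂ f
  have hf : ∀ x i, f x i = e (x i) := fun x i => rfl
  refine ⟨Q.map (U.toLinearEquiv : QuditSpace A n →ₗ[ℂ] QuditSpace B n), ?_, fun S hS E hE => ?_⟩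
  · rw [LinearEquiv.finrank_map_eq, hQ.1, Fintype.card_congr e]
  · have hEf : ActsOn S (E.submatrix f f) := by
      refine ⟨?_, fun x y x' y' h1 h2 h3 => hE.2 _ _ _ _ ?_ ?_ ?_⟩
      · rintro x y ⟨i, hi, hxy⟩
        exact hE.1 _ _ ⟨i, hi, by simpa [hf] using hxy⟩
      all_goals simpa [hf]
    obtain ⟨l, hl⟩ := hQ.2 S hS _ hEf
    refine ⟨l, ?_⟩
    rintro _ ⟨u, hu, rfl⟩ _ ⟨v, hv, rfl⟩
    have hU : (WithLp.toLp 2 (E.mulVec (WithLp.ofLp (U v))) : QuditSpace B n) =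
        U (WithLp.toLp 2 ((E.submatrix f f).mulVec (WithLp.ofLp v))) := by
      ext x
      obtain ⟨y, rfl⟩ := f.surjective x
      simp only [U, LinearIsometryEquiv.piLpCongrLeft_apply, Matrix.mulVec, dotProduct,
        Equiv.piCongrLeft'_apply, Equiv.symm_apply_apply, Matrix.submatrix_apply]
      rw [← Equiv.sum_comp f]
      simp only [Equiv.symm_apply_apply]
    have := hl u hu v hv
    rw [← U.inner_map_map, ← hU, ← U.inner_map_map u v] at this
    exact this

/-! ### Cyclic codes and the BCH bound -/

open Polynomial in
theorem finrank_cyclicCode {F : Type*} [Field F] {n : ℕ} {g : F[X]} (hg : g.Monic)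
    (hn : g.natDegree ≤ n) : Module.finrank F (cyclicCode n g) + g.natDegree = n := by
  set m := n - g.natDegree with hm
  have hnm : n = m + g.natDegree := by omega
  let φ := degreeLTEquiv F n
  have hφ : ∀ v : Fin n → F, (φ.symm v : F[X]) = ∑ i : Fin n, C (v i) * X ^ (i : ℕ) := by
    intro v
    simp only [C_mul_X_pow_eq_monomial]
    rfl
  have hdeg : ∀ p : F[X], p ∈ degreeLT F m ↔ g * p ∈ degreeLT F n := by
    intro p
    rcases eq_or_ne p 0 with rfl | hp
    · simp
    rw [mem_degreeLT, mem_degreeLT, mul_comm, hg.degree_mul, degree_eq_natDegree hg.ne_zero,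
      degree_eq_natDegree hp]
    norm_cast
    omega
  -- Multiplication by `g` identifies polynomials of degree below `n - deg g` with codewords.
  let ψ : degreeLT F m →ₗ[F] degreeLT F n :=
    (LinearMap.mulLeft F g).restrict fun p hp => (hdeg p).1 hp
  have hψ : Function.Injective ψ := by
    intro p p' h
    have : g * p = g * p' := congrArg Subtype.val h
    exact Subtype.ext (mul_left_cancel₀ hg.ne_zero this)
  have hrange : cyclicCode n g = LinearMap.range (φ.toLinearMap ∘ₗ ψ) := by
    ext v
    change g ∣ ∑ i : Fin n, C (v i) * X ^ (i : ℕ) ↔ _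
    rw [← hφ]
    constructor
    · rintro ⟨p, hp⟩
      refine ⟨⟨p, (hdeg p).2 (hp ▸ (φ.symm v).2)⟩, ?_⟩
      change φ _ = v
      rw [← LinearEquiv.eq_symm_apply]
      exact Subtype.ext hp.symm
    · rintro ⟨p, rfl⟩
      refine ⟨p, ?_⟩
      change (φ.symm (φ (ψ p)) : F[X]) = g * p
      rw [φ.symm_apply_apply]
      rfl
  rw [hrange, LinearMap.finrank_range_of_inj (f := φ.toLinearMap ∘ₗ ψ) (by simpa using hψ),
    (degreeLTEquiv F m).finrank_eq, Module.finrank_fin_fun]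
  omega

open Polynomial in
/-- The BCH bound. -/
theorem eq_zero_of_forall_sum_mul_pow_eq_zero {K : Type*} [Field K] {n : ℕ} {β : K}
    (hβ : IsPrimitiveRoot β n) {s m : ℕ} {S : Finset (Fin n)} (hS : S.card ≤ m) {b : Fin n → K}
    (hb : ∀ i ∉ S, b i = 0)
    (h : ∀ i < m, ∑ j : Fin n, b j * (β ^ (s + i)) ^ (j : ℕ) = 0) : b = 0 := by
  classical
  -- The hypotheses say that a weighted evaluation functional kills all monomials of degree below
  -- `m`. It is then applied to the polynomial vanishing at every point of `S` except `j₀`.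
  have hpoly : ∀ p : K[X], p.natDegree < m →
      ∑ j : Fin n, b j * (β ^ s) ^ (j : ℕ) * p.eval (β ^ (j : ℕ)) = 0 := by
    intro p hp
    simp only [eval_eq_sum_range' hp, Finset.mul_sum]
    rw [Finset.sum_comm]
    refine Finset.sum_eq_zero fun i hi => ?_
    rw [← mul_zero (p.coeff i), ← h i (Finset.mem_range.1 hi), Finset.mul_sum]
    refine Finset.sum_congr rfl fun j _ => ?_
    rw [pow_add, mul_pow, pow_right_comm]
    ring
  funext j₀
  by_cases hj : j₀ ∈ S
  swap
  · exact hb j₀ hj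
  have h0 : β ≠ 0 := hβ.ne_zero (by have := j₀.2; omega)
  have hdeg : (∏ j ∈ S.erase j₀, (X - C (β ^ (j : ℕ)))).natDegree < m := by
    rw [natDegree_prod_of_monic _ _ fun j _ => monic_X_sub_C _]
    simp only [natDegree_X_sub_C, Finset.sum_const, smul_eq_mul, mul_one]
    exact (Finset.card_erase_lt_of_mem hj).trans_le hS
  have key := hpoly _ hdeg
  rw [Finset.sum_eq_single j₀] at key
  · rw [mul_eq_zero, mul_eq_zero, eval_prod, Finset.prod_eq_zero_iff] at key
    rcases key with (h | h) | ⟨j, hjS, h⟩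
    · exact h
    · exact absurd h (by positivity)
    · rw [eval_sub, eval_X, eval_C, sub_eq_zero] at h
      exact absurd (Fin.ext (hβ.pow_inj j₀.2 j.2 h)).symm (Finset.ne_of_mem_erase hjS)
  · intro j _ hne
    by_cases hjS : j ∈ S
    · rw [eval_prod, Finset.prod_eq_zero (Finset.mem_erase.2 ⟨hne, hjS⟩) (by simp), mul_zero]
    · rw [hb j hjS, zero_mul, zero_mul]
  · simp

/-! ### Minimal polynomials in a quadratic extension -/

section QuadraticExtension

open Polynomial

variable {F K : Type*} [Field F] [Field K] [Algebra F K]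

theorem mem_minpolySet {α : K} {I : Finset ℕ} {p : F[X]} :
    p ∈ minpolySet F α I ↔ ∃ i ∈ I, minpoly F (α ^ i) = p := by
  simp [minpolySet]

theorem isCoprime_minpoly [FiniteDimensional F K] {x y : K} (h : minpoly F x ≠ minpoly F y) :
    IsCoprime (minpoly F x) (minpoly F y) := by
  have hx := IsIntegral.of_finite F x
  have hy := IsIntegral.of_finite F y
  rw [(minpoly.irreducible hx).coprime_iff_not_dvd]
  intro hd
  exact h (eq_of_monic_of_associated (minpoly.monic hx) (minpoly.monic hy)
    ((minpoly.irreducible hx).associated_of_dvd (minpoly.irreducible hy) hd))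

theorem prod_dvd_of_subset_minpolySet [FiniteDimensional F K] {α : K} {I : Finset ℕ}
    {T : Finset F[X]} (hT : T ⊆ minpolySet F α I) {f : F[X]} (h : ∀ p ∈ T, p ∣ f) :
    ∏ p ∈ T, p ∣ f := by
  refine Finset.prod_dvd_of_coprime (fun p hp p' hp' hne => ?_) h
  obtain ⟨i, _, rfl⟩ := mem_minpolySet.1 (hT hp)
  obtain ⟨j, _, rfl⟩ := mem_minpolySet.1 (hT hp')
  exact isCoprime_minpoly hne

theorem monic_of_mem_minpolySet [FiniteDimensional F K] {α : K} {I : Finset ℕ} {p : F[X]}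
    (hp : p ∈ minpolySet F α I) : p.Monic := by
  obtain ⟨i, _, rfl⟩ := mem_minpolySet.1 hp
  exact minpoly.monic (IsIntegral.of_finite F _)

theorem minpolySet_subset_range {α : K} {n : ℕ} (hα : IsPrimitiveRoot α n) (hn : 0 < n)
    (I : Finset ℕ) : minpolySet F α I ⊆ minpolySet F α (Finset.range n) := by
  intro p hp
  obtain ⟨i, _, rfl⟩ := mem_minpolySet.1 hp
  refine mem_minpolySet.2 ⟨i % n, Finset.mem_range.2 (Nat.mod_lt _ hn), ?_⟩
  rw [hα.eq_orderOf, pow_mod_orderOf]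

theorem prod_minpolySet_range [FiniteDimensional F K] {α : K} {n : ℕ}
    (hα : IsPrimitiveRoot α n) (hn : 0 < n) :
    ∏ p ∈ minpolySet F α (Finset.range n), p = X ^ n - 1 := by
  classical
  refine eq_of_monic_of_associated (monic_prod_of_monic _ _ fun p hp => monic_of_mem_minpolySet hp)
    (monic_X_pow_sub_C 1 hn.ne') (associated_of_dvd_dvd ?_ ?_)
  · refine prod_dvd_of_subset_minpolySet subset_rfl fun p hp => ?_
    obtain ⟨i, _, rfl⟩ := mem_minpolySet.1 hp
    apply minpoly.dvd
    simp [pow_right_comm, hα.pow_eq_one]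
  · rw [← map_dvd_map' (algebraMap F K)]
    rw [Polynomial.map_sub, Polynomial.map_pow, map_X, Polynomial.map_one, 
      X_pow_sub_one_eq_prod hn hα]
    refine Finset.prod_dvd_of_coprime (fun x _ y _ hne => ?_) fun x hx => ?_
    · exact isCoprime_X_sub_C_of_isUnit_sub (sub_ne_zero.2 hne).isUnit
    · have : NeZero n := ⟨hn.ne'⟩
      obtain ⟨i, hi, rfl⟩ := hα.eq_pow_of_pow_eq_one ((mem_nthRootsFinset hn _).1 hx)
      refine dvd_trans ?_ (Polynomial.map_dvd _ (Finset.dvd_prod_of_mem _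
        (mem_minpolySet.2 ⟨i, Finset.mem_range.2 hi, rfl⟩)))
      rw [dvd_iff_isRoot, IsRoot.def, eval_map_algebraMap, minpoly.aeval]

variable [Fintype F]

theorem minpoly_pow_card [FiniteDimensional F K] (x : K) :
    minpoly F (x ^ Fintype.card F) = minpoly F x :=
  minpoly.algEquiv_eq (FiniteField.frobeniusAlgEquivOfAlgebraic F K) x

theorem minpoly_eq_iff_of_finrank_two (h2 : Module.finrank F K = 2) {x y : K} :
    minpoly F x = minpoly F y ↔ x = y ∨ x = y ^ Fintype.card F := by
  have : FiniteDimensional F K := Module.finite_of_finrank_pos (by omega)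
  have : Finite K := Module.finite_of_finite F
  constructor
  · intro h
    obtain ⟨σ, rfl⟩ := (Normal.minpoly_eq_iff_mem_orbit K).1 h
    obtain ⟨i, rfl⟩ := (FiniteField.bijective_frobeniusAlgEquivOfAlgebraic_pow F K).2 σ
    have hi := i.2
    obtain hi | hi : i.1 = 0 ∨ i.1 = 1 := by omega
    · left; simp [hi]
    · right; simp [hi]
  · rintro (rfl | rfl)
    · rfl
    · exact minpoly_pow_card y

theorem natDegree_minpoly_of_pow_card_eq [FiniteDimensional F K] {x : K}
    (hx : x ^ Fintype.card F = x) : (minpoly F x).natDegree = 1 := by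
  have hirr := minpoly.irreducible (IsIntegral.of_finite F x)
  rw [← Nat.dvd_one, hirr.natDegree_dvd_iff_dvd_X_pow_card_pow_sub_X]
  apply minpoly.dvd
  simp [hx]

theorem natDegree_minpoly_of_pow_card_ne (h2 : Module.finrank F K = 2) {x : K}
    (hx : x ^ Fintype.card F ≠ x) : (minpoly F x).natDegree = 2 := by
  have : FiniteDimensional F K := Module.finite_of_finrank_pos (by omega)
  have hle := minpoly.natDegree_le (A := F) x
  have hpos := minpoly.natDegree_pos (IsIntegral.of_finite F x)
  have hne : (minpoly F x).natDegree ≠ 1 := fun h => hx ?_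
  · omega
  obtain ⟨a, rfl⟩ := minpoly.natDegree_eq_one_iff.1 h
  rw [← map_pow, FiniteField.pow_card]

end QuadraticExtension

/-! ### Duality, trace vectors and the two windows of zeros -/

theorem mem_cyclicCode {F : Type*} [Field F] {n : ℕ} {g : Polynomial F} {v : Fin n → F} :
    v ∈ cyclicCode n g ↔ g ∣ ∑ i : Fin n, Polynomial.C (v i) * Polynomial.X ^ (i : ℕ) :=
  Iff.rfl

theorem cyclicCode_anti {F : Type*} [Field F] (n : ℕ) {g g' : Polynomial F} (h : g ∣ g') :
    cyclicCode n g' ≤ cyclicCode n g :=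
  fun _ hv => h.trans hv

/-- If no nonzero vector supported on `S` is orthogonal to `C`, then `C` takes all values on `S`. -/
theorem exists_mem_eq_on_of_dual {F ι : Type*} [Field F] [Fintype ι] {C : Submodule F (ι → F)}
    {S : Finset ι}
    (h : ∀ b : ι → F, (∀ i ∉ S, b i = 0) → (∀ w ∈ C, ∑ i, b i * w i = 0) → b = 0) (x : ι → F) :
    ∃ w ∈ C, ∀ i ∈ S, w i = x i := by
  classical
  let Z : Submodule F (ι → F) :=
    { carrier := {z | ∀ i ∈ S, z i = 0}
      zero_mem' := fun _ _ => rfl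
      add_mem' := fun hz hz' i hi => by rw [Pi.add_apply, hz i hi, hz' i hi, add_zero]
      smul_mem' := fun r z hz i hi => by rw [Pi.smul_apply, hz i hi, smul_zero] }
  have hZ : ∀ z, z ∈ Z ↔ ∀ i ∈ S, z i = 0 := fun z => Iff.rfl
  -- Otherwise a nonzero functional kills `C` and `Z`; its coefficient vector is supported on `S`
  -- and orthogonal to `C`.
  have htop : C ⊔ Z = ⊤ := by
    by_contra hne
    obtain ⟨f, hf0, hf⟩ := Submodule.exists_le_ker_of_lt_top _ (lt_top_iff_ne_top.2 hne)
    have hsum : ∀ w, f w = ∑ i, f (Pi.single i 1) * w i := by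
      intro w
      conv_lhs => rw [pi_eq_sum_univ' w, map_sum]
      exact Finset.sum_congr rfl fun i _ => by rw [map_smul, smul_eq_mul, mul_comm]
    have hb := h (fun i => f (Pi.single i 1)) (fun i hi => ?_) fun w hw => ?_
    · exact hf0 (LinearMap.ext fun w => by simp [hsum w, fun i => congrFun hb i])
    · refine hf (Submodule.mem_sup_right ((hZ _).2 fun j hj => ?_))
      exact Pi.single_eq_of_ne ((by rintro rfl; exact hi hj)) _
    · rw [← hsum]
      exact hf (Submodule.mem_sup_left hw)
  obtain ⟨w, hw, z, hz, rfl⟩ := Submodule.mem_sup.1 (htop ▸ Submodule.mem_top : x ∈ C ⊔ Z)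
  exact ⟨w, hw, fun i hi => by simp [(hZ z).1 hz i hi]⟩

section QuadraticExtension

open Polynomial

variable {F K : Type*} [Field F] [Field K] [Algebra F K]

theorem aeval_sum_C_mul_X_pow {n : ℕ} (v : Fin n → F) (x : K) :
    aeval x (∑ j : Fin n, C (v j) * X ^ (j : ℕ)) =
      ∑ j : Fin n, algebraMap F K (v j) * x ^ (j : ℕ) := by
  simp

variable [Fintype F]

theorem algebraMap_trace_of_finrank_two (h2 : Module.finrank F K = 2) (x : K) :
    algebraMap F K (Algebra.trace F K x) = x + x ^ Fintype.card F := by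
  have : FiniteDimensional F K := Module.finite_of_finrank_pos (by omega)
  have : Finite K := Module.finite_of_finite F
  rw [FiniteField.algebraMap_trace_eq_sum_pow, h2, Finset.sum_range_succ, Finset.sum_range_one,
    Nat.card_eq_fintype_card, pow_zero, pow_one, pow_one]

theorem natDegree_prod_minpolySet (h2 : Module.finrank F K = 2) {α : K} {I : Finset ℕ} {i₀ : ℕ}
    (hi₀ : i₀ ∈ I) (hinj : Set.InjOn (fun i => minpoly F (α ^ i)) I)
    (h₀ : (α ^ i₀) ^ Fintype.card F = α ^ i₀)
    (h : ∀ i ∈ I, i ≠ i₀ → (α ^ i) ^ Fintype.card F ≠ α ^ i) :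
    (∏ p ∈ minpolySet F α I, p).natDegree + 1 = 2 * I.card := by
  classical
  have : FiniteDimensional F K := Module.finite_of_finrank_pos (by omega)
  rw [natDegree_prod_of_monic _ _ fun p hp => monic_of_mem_minpolySet hp]
  unfold minpolySet
  rw [Finset.sum_image hinj, ← Finset.add_sum_erase _ _ hi₀, natDegree_minpoly_of_pow_card_eq h₀,
    Finset.sum_congr rfl fun i hi => natDegree_minpoly_of_pow_card_ne h2
      (h i (Finset.mem_of_mem_erase hi) (Finset.ne_of_mem_erase hi)),
    Finset.sum_const, ← Finset.card_erase_add_one hi₀]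
  simp only [smul_eq_mul]
  ring

theorem sum_fin_pow_eq_zero {n : ℕ} {y : K} (hy : y ^ n = 1) (hy1 : y ≠ 1) :
    ∑ j : Fin n, y ^ (j : ℕ) = 0 := by
  rw [Fin.sum_univ_eq_sum_range fun j => y ^ j, geom_sum_eq hy1, hy, sub_self, zero_div]

/-- Expanding the trace gives geometric sums with ratios `y / x` and `y / x ^ q`, where `q` is the
order of `F`. Both ratios are `n`-th roots of unity, and neither is `1` because `y` is not conjugate
to `x`. -/
theorem aeval_trace_vector_eq_zero (h2 : Module.finrank F K = 2) {n : ℕ} {x y : K}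
    (hx : x ^ n = 1) (hy : y ^ n = 1) (hxy : minpoly F y ≠ minpoly F x) (a : K) :
    aeval y (∑ j : Fin n, C (Algebra.trace F K (a * x⁻¹ ^ (j : ℕ))) * X ^ (j : ℕ)) = 0 := by
  have : FiniteDimensional F K := Module.finite_of_finrank_pos (by omega)
  have h : ∀ z : K, z ^ n = 1 → minpoly F y ≠ minpoly F z →
      ∑ j : Fin n, (z⁻¹ * y) ^ (j : ℕ) = 0 := by
    intro z hz hyz
    refine sum_fin_pow_eq_zero (by rw [mul_pow, inv_pow, hz, hy, inv_one, mul_one]) fun h1 => ?_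
    rw [inv_mul_eq_iff_eq_mul₀, mul_one] at h1
    · exact hyz (h1 ▸ rfl)
    · rintro rfl
      rw [inv_zero, zero_mul] at h1
      exact zero_ne_one h1
  have h₁ := h x hx hxy
  have h₂ := h (x ^ Fintype.card F) (by rw [pow_right_comm, hx, one_pow])
    (by rwa [minpoly_pow_card])
  calc _ = a * ∑ j : Fin n, (x⁻¹ * y) ^ (j : ℕ) + a ^ Fintype.card F *
        ∑ j : Fin n, ((x ^ Fintype.card F)⁻¹ * y) ^ (j : ℕ) := by
        rw [aeval_sum_C_mul_X_pow, Finset.mul_sum, Finset.mul_sum, ← Finset.sum_add_distrib]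
        refine Finset.sum_congr rfl fun j _ => ?_
        rw [algebraMap_trace_of_finrank_two h2, mul_pow, mul_pow, mul_pow, ← inv_pow,
          pow_right_comm x⁻¹]
        ring
    _ = 0 := by rw [h₁, h₂, mul_zero, mul_zero, add_zero]

/-- The CSS code of the two cyclic codes attached to a primitive element of a quadratic extension. -/
theorem isQuantumCode_cssCode_genPoly {q c : ℕ} (hq3 : 3 ≤ q) (hc : 2 ≤ c) (hcq : c < q) (α : K)
    (hF : Fintype.card F = q) (h2 : Module.finrank F K = 2) (hα : IsPrimitiveRoot α (q ^ 2 - 1)) :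
    cyclicCode (q ^ 2 - 1) (genPolyTwo F α (q ^ 2 - 1) q c) ≤
        cyclicCode (q ^ 2 - 1) (genPolyOne F α c) ∧
      IsQuantumCode (cssCode (cyclicCode (q ^ 2 - 1) (genPolyOne F α c))
        (cyclicCode (q ^ 2 - 1) (genPolyTwo F α (q ^ 2 - 1) q c))) (q ^ 2 - 4 * c + 5) c := by
  classical
  have : FiniteDimensional F K := Module.finite_of_finrank_pos (by omega)
  -- This keeps the natural subtraction in `q ^ 2 - 4 * c + 5` from truncating.
  have hqq : 4 * c + 1 ≤ q ^ 2 := by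
    obtain ⟨r, rfl⟩ := Nat.exists_eq_add_of_lt hcq
    obtain ⟨s, rfl⟩ := Nat.exists_eq_add_of_le hc
    nlinarith
  generalize hn : q ^ 2 - 1 = n at *
  have hqn : q ^ 2 = n + 1 := by omega
  have hn0 : 0 < n := by omega
  -- Conjugate exponents stay below `n`, so equal powers of `α` have equal exponents.
  have hqmul : ∀ i < q - 1, i * q + 1 < n := by
    intro i hi
    obtain ⟨r, hr⟩ := Nat.exists_eq_add_of_lt hi
    obtain rfl : q = i + r + 2 := by omega
    nlinarith
  have hqn2 : 2 * q < n := by nlinarith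
  have hαn := hα.pow_eq_one
  have hwrap : ∀ t, α ^ ((q + t) * q) = α ^ (t * q + 1) := by
    intro t
    rw [show (q + t) * q = n + (t * q + 1) by nlinarith, pow_add, hαn, one_mul]
  have hmin : ∀ i j, minpoly F (α ^ i) = minpoly F (α ^ j) ↔
      α ^ i = α ^ j ∨ α ^ i = α ^ (j * q) := by
    intro i j
    rw [minpoly_eq_iff_of_finrank_two h2, hF, pow_mul]
  -- exponents `0, …, c - 2`
  have hdeg₁ : (genPolyOne F α c).natDegree + 1 = 2 * (c - 1) := by
    have h := natDegree_prod_minpolySet (F := F) h2 (α := α) (I := Finset.range (c - 1)) (i₀ := 0)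
      (by simp; omega) ?_ (by simp) ?_
    · rwa [Finset.card_range] at h
    · intro i hi j hj hij
      simp only [Finset.coe_range, Set.mem_Iio] at hi hj
      have := hqmul j (by omega)
      rcases (hmin i j).1 hij with h | h
      · exact hα.pow_inj (by omega) (by omega) h
      · have := hα.pow_inj (by omega) (by omega) h
        rcases j with _ | j
        · simpa using this
        · rw [add_mul] at this
          omega
    · intro i hi hi0
      rw [Finset.mem_range] at hi
      rw [hF, ← pow_mul]
      intro h
      have := hα.pow_inj (by have := hqmul i (by omega); omega) (by omega) h
      have := Nat.eq_of_mul_eq_mul_left (by omega) (this.trans (mul_one i).symm)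
      omega
  -- exponents `q + 1, …, q + c - 1`
  have hdeg₂ : (∏ p ∈ minpolySet F α (Finset.Icc (q + 1) (q + c - 1)), p).natDegree + 1 =
      2 * (c - 1) := by
    have h := natDegree_prod_minpolySet (F := F) h2 (α := α)
      (I := Finset.Icc (q + 1) (q + c - 1)) (i₀ := q + 1) (by simp; omega) ?_ ?_ ?_
    · rw [h, Nat.card_Icc]
      omega
    · intro i hi j hj hij
      simp only [Finset.coe_Icc, Set.mem_Icc] at hi hj
      obtain ⟨s, rfl⟩ := Nat.exists_eq_add_of_le hi.1
      obtain ⟨t, rfl⟩ := Nat.exists_eq_add_of_le hj.1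
      have := hqmul (1 + t) (by omega)
      rcases (hmin _ _).1 hij with h | h
      · exact hα.pow_inj (by omega) (by omega) h
      · rw [add_assoc q 1 t, hwrap] at h
        have := hα.pow_inj (by omega) (by omega) h
        rcases t with _ | t
        · omega
        · rw [add_mul, add_mul] at this
          omega
    · rw [hF, ← pow_mul, hwrap, one_mul]
    · intro i hi hi0
      rw [Finset.mem_Icc] at hi
      obtain ⟨s, rfl⟩ := Nat.exists_eq_add_of_le hi.1
      have := hqmul (1 + s) (by omega)
      rw [hF, ← pow_mul, add_assoc q 1 s, hwrap]
      intro h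
      have := hα.pow_inj (by omega) (by omega) h
      rcases s with _ | s
      · omega
      · rw [add_mul, add_mul] at this
        omega
  have hdisj : ∀ i < c - 1, ∀ j ∈ Finset.Icc (q + 1) (q + c - 1),
      minpoly F (α ^ j) ≠ minpoly F (α ^ i) := by
    intro i hi j hj hij
    rw [Finset.mem_Icc] at hj
    have := hqmul i (by omega)
    rcases (hmin j i).1 hij with h | h
    · have := hα.pow_inj (by omega) (by omega) h
      omega
    · have := hα.pow_inj (by omega) (by omega) h
      -- The conjugates `0` and `q` lie below the second window; for larger exponents, `i * q ≥ 2 *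
      -- q` lies above it.
      rcases i with _ | _ | i
      · omega
      · omega
      · rw [add_mul, add_mul] at this
        omega
  have hsub := minpolySet_subset_range (F := F) hα hn0
  have hmonic : ∀ T ⊆ minpolySet F α (Finset.range n), (∏ p ∈ T, p).Monic := fun T hT =>
    monic_prod_of_monic _ _ fun p hp => monic_of_mem_minpolySet (hT hp)
  have hprod : genPolyTwo F α n q c * ∏ p ∈ minpolySet F α (Finset.Icc (q + 1) (q + c - 1)), p =
      X ^ n - 1 := by
    rw [← prod_minpolySet_range (F := F) hα hn0, ← Finset.prod_sdiff (hsub _)]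
    unfold genPolyTwo
    congr!
  have hmonic₂ : (genPolyTwo F α n q c).Monic := hmonic _ Finset.sdiff_subset
  have hdegn : (genPolyTwo F α n q c).natDegree +
      (∏ p ∈ minpolySet F α (Finset.Icc (q + 1) (q + c - 1)), p).natDegree = n := by
    rw [← hmonic₂.natDegree_mul (hmonic _ (hsub _)), hprod, ← C_1, natDegree_X_pow_sub_C]
  have hdvd : genPolyOne F α c ∣ genPolyTwo F α n q c := by
    refine Finset.prod_dvd_prod_of_subset _ _ _ fun p hp => ?_
    refine Finset.mem_sdiff.2 ⟨hsub _ hp, fun hp' => ?_⟩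
    obtain ⟨i, hi, rfl⟩ := mem_minpolySet.1 hp
    obtain ⟨j, hj, hij⟩ := mem_minpolySet.1 hp'
    exact hdisj i (Finset.mem_range.1 hi) j hj hij
  have hle := cyclicCode_anti n hdvd
  have hmonic₁ : (genPolyOne F α c).Monic := hmonic _ (hsub _)
  have hrank₁ := finrank_cyclicCode (n := n) hmonic₁ (by omega)
  have hrank₂ := finrank_cyclicCode (n := n) hmonic₂ (by omega)
  refine ⟨hle, isQuantumCode_cssCode hle (by omega) ?_ ?_⟩
  · intro S hS v hv hvS
    rw [mem_cyclicCode] at hv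
    have hvz : (fun j => algebraMap F K (v j)) = 0 := by
      refine eq_zero_of_forall_sum_mul_pow_eq_zero hα (s := 0) (m := c - 1) (S := S) (by omega)
        (fun i hi => by rw [hvS i hi, map_zero]) fun i hi => ?_
      rw [zero_add, ← aeval_sum_C_mul_X_pow, ← minpoly.dvd_iff]
      refine dvd_trans ?_ hv
      exact Finset.dvd_prod_of_mem (fun p : F[X] => p)
        (mem_minpolySet.2 ⟨i, Finset.mem_range.2 hi, rfl⟩)
    funext j
    simpa using congrFun hvz j
  · intro S hS
    refine exists_mem_eq_on_of_dual fun b hbS hb => ?_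
    have hbz : (fun j => algebraMap F K (b j)) = 0 := by
      refine eq_zero_of_forall_sum_mul_pow_eq_zero hα.inv (s := q + 1) (m := c - 1) (S := S)
        (by omega) (fun i hi => by rw [hbS i hi, map_zero]) fun i hi => ?_
      -- Orthogonality to the trace vectors for every `a` says that the sum is orthogonal to all of
      -- `K` under the trace form.
      refine (traceForm_nondegenerate F K).1 _ fun a => ?_
      rw [← hb (fun j => Algebra.trace F K (a * (α ^ (q + 1 + i))⁻¹ ^ (j : ℕ))) ?_]
      · rw [Algebra.traceForm_apply, Finset.sum_mul, map_sum]
        refine Finset.sum_congr rfl fun j _ => ?_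
        rw [← smul_eq_mul (b j), ← map_smul, Algebra.smul_def, inv_pow α]
        congr 1
        ring
      · rw [mem_cyclicCode]
        refine prod_dvd_of_subset_minpolySet Finset.sdiff_subset fun p hp => ?_
        obtain ⟨hp₁, hp₂⟩ := Finset.mem_sdiff.1 hp
        obtain ⟨m, _, rfl⟩ := mem_minpolySet.1 hp₁
        refine minpoly.dvd _ _ (aeval_trace_vector_eq_zero h2 ?_ ?_ ?_ a)
        · rw [pow_right_comm, hαn, one_pow]
        · rw [pow_right_comm, hαn, one_pow]
        · exact fun h => hp₂ (mem_minpolySet.2 ⟨_, Finset.mem_Icc.2 ⟨by omega, by omega⟩, h.symm⟩)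
    funext j
    simpa using congrFun hbz j

end QuadraticExtension

/-! ### Existence of the fields and conclusion -/

theorem exists_quadraticExtension_isPrimitiveRoot {q : ℕ} (hq : IsPrimePow q) :
    ∃ (F K : Type) (_ : Field F) (_ : Fintype F) (_ : Field K) (_ : Algebra F K) (α : K),
      Fintype.card F = q ∧ Module.finrank F K = 2 ∧ IsPrimitiveRoot α (q ^ 2 - 1) := by
  obtain ⟨p, k, hp, hk, rfl⟩ := hq
  have : Fact p.Prime := ⟨hp.nat_prime⟩
  let F := GaloisField p k
  let K := FiniteField.Extension F p 2
  have := Fintype.ofFinite F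
  have hcard : Nat.card F = p ^ k := GaloisField.card p k hk.ne'
  obtain ⟨g, hg⟩ := IsCyclic.exists_generator (α := Kˣ)
  refine ⟨F, K, inferInstance, inferInstance, inferInstance, inferInstance, g,
    by rw [Fintype.card_eq_nat_card, hcard], FiniteField.finrank_extension F p 2, ?_⟩
  rw [IsPrimitiveRoot.coe_units_iff, ← hcard, ← FiniteField.natCard_extension F p 2,
    ← Nat.card_units, ← orderOf_eq_card_of_forall_mem_zpowers hg]
  exact IsPrimitiveRoot.orderOf g

theorem mainTheorem4 (q c : ℕ) (hq : IsPrimePow q) (hq3 : 3 ≤ q) (hc : 2 ≤ c) (hcq : c < q) :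
    (∃ Q : Submodule ℂ (QuditSpace (Fin q) (q ^ 2 - 1)),
      IsQuantumCode Q (q ^ 2 - 4 * c + 5) c) ∧
    (∀ (F K : Type*) [Field F] [Fintype F] [Field K] [Algebra F K] (α : K),
      Fintype.card F = q → Module.finrank F K = 2 → IsPrimitiveRoot α (q ^ 2 - 1) →
      ∀ C₁ C₂ : Submodule F (Fin (q ^ 2 - 1) → F),
        C₁ = cyclicCode (q ^ 2 - 1) (genPolyOne F α c) →
        C₂ = cyclicCode (q ^ 2 - 1) (genPolyTwo F α (q ^ 2 - 1) q c) →
        C₂ ≤ C₁ ∧ IsQuantumCode (cssCode C₁ C₂) (q ^ 2 - 4 * c + 5) c) := by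
  refine ⟨?_, ?_⟩
  · obtain ⟨F, K, _, _, _, _, α, hF, h2, hα⟩ := exists_quadraticExtension_isPrimitiveRoot hq
    exact (isQuantumCode_cssCode_genPoly hq3 hc hcq α hF h2 hα).2.relabel
      (Fintype.equivFinOfCardEq hF)
  · rintro F K _ _ _ _ α hF h2 hα C₁ C₂ rfl rfl
    exact isQuantumCode_cssCode_genPoly hq3 hc hcq α hF h2 hα
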